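/- Conventions. A (non-atomic) Lebesgue space is a complete measure space $(X,\mathcal S(X),\mu)$ that is isomorphic mod $0$ to the interval $[0,\mu(X))\subseteq\mathbb R$ with Lebesgue measure. A transformation $T$ of $X$ is nonsingular if it is measurable and $\mu(T^{-1}A)=0\iff\mu(A)=0$ for all measurable $A$. Two systems $(X,\mu,T)$ and $(X_1,\mu_1,T_1)$ are measure-theoretically isomorphic if there are sets $X'\subseteq X$, $X_1'\subseteq X_1$ with null complements, $T(X')\subseteq X'$, $T_1(X_1')\subseteq X_1'$, and a bimeasurable, measure-preserving bijection $\varphi:X'\to X_1'$ with $\varphi\circ T=T_1\circ\varphi$ on $X'$. A metric on a measure space is good if open sets are measurable, all nonempty open sets have positive measure, and the measure is regular. A nonsingular system $(X,\mu,T)$ is measurably sensitive if, whenever a nonsingular system $(X_1,\mu_1,T_1)$ on a Lebesgue space is measure-theoretically isomorphic to $(X,\mu,T)$ and $d$ is a good metric on $X_1$, there exists $\delta>0$ such that for all $x\in X_1$ and all $\varepsilon>0$ there exists $N\in\mathbb N$ such that for all integers $n\ge N$ $$\mu_1\{y\in B_\varepsilon(x): d(T_1^n x,T_1^n y)>\delta\}>0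 .$$ A transformation $S$ of a finite measure space $(Y,\nu)$ is lightly mixing if $\liminf_{k\to\infty}\nu(S^{-k}A\cap B)>0$ for all measurable $A,B\subseteq Y$ of positive measure. Theorem. Let $(X,\mu)$ be a non-atomic Lebesgue space with $0<\mu(X)<\infty$, and let $T:X\to X$ be an ergodic measure-preserving transformation (not necessarily invertible). If $T$ is measurably sensitive, then there are an integer $n\ge 1$ and $n$ pairwise disjoint measurable sets $A_1,\dots,A_n\subseteq X$ of positive measure such that $T^{-n}(A_i)=A_i$ for every $i$, $\mu\bigl(X\setminus\bigcup_{i}A_i\bigr)=0$, and the restriction of $T^n$ to each $A_i$ is lightly mixing with respect to $\mu|_{A_i}$. -/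

import Mathlib

open MeasureTheory Filter Set

universe u v

namespace MeasurableSensitivity

/-- `φ` restricts to an isomorphism of measure spaces between the conull sets `X₀ ⊆ X` and
`Y₀ ⊆ Y`: a bijection that preserves measurability (with respect to the completions) in both
directions and preserves the measure.  When `μ` and `ν` are complete, `NullMeasurableSet` is the
same as `MeasurableSet`. -/
structure IsIsoMod0 {X : Type u} {Y : Type v} [MeasurableSpace X] [MeasurableSpace Y]
    (μ : Measure X) (ν : Measure Y) (X₀ : Set X) (Y₀ : Set Y) (φ : X → Y) : Prop where
  conull_source : μ X₀ᶜ = 0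
  conull_target : ν Y₀ᶜ = 0
  bijOn : BijOn φ X₀ Y₀
  nullMeasurableSet_image_iff :
    ∀ A ⊆ X₀, NullMeasurableSet (φ '' A) ν ↔ NullMeasurableSet A μ
  measure_image : ∀ A ⊆ X₀, NullMeasurableSet A μ → ν (φ '' A) = μ A

/-- A non-atomic Lebesgue space of finite or `σ`-finite measure: a complete measure space that is
isomorphic mod `0` to the interval `[0, μ(X)) ⊆ ℝ` with Lebesgue measure. -/
structure IsLebesgueSpace {X : Type u} [MeasurableSpace X] (μ : Measure X) : Prop where
  complete : μ.IsComplete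
  exists_iso : ∃ (X₀ : Set X) (Y₀ : Set ℝ) (φ : X → ℝ),
    IsIsoMod0 μ (volume.restrict {t : ℝ | 0 ≤ t ∧ ENNReal.ofReal t < μ univ}) X₀ Y₀ φ

/-- `T` is a nonsingular transformation of `(X, μ)`. -/
structure IsNonsingular {X : Type u} [MeasurableSpace X] (μ : Measure X) (T : X → X) :
    Prop where
  measurable : Measurable T
  preimage_null_iff : ∀ A : Set X, MeasurableSet A → (μ (T ⁻¹' A) = 0 ↔ μ A = 0)

/-- The dynamical systems `(X, μ, T)` and `(Y, ν, S)` are measure-theoretically isomorphic: there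
is an isomorphism mod `0` between forward invariant conull sets that intertwines `T` and `S`. -/
def AreIsomorphic {X : Type u} {Y : Type v} [MeasurableSpace X] [MeasurableSpace Y]
    (μ : Measure X) (T : X → X) (ν : Measure Y) (S : Y → Y) : Prop :=
  ∃ (X₀ : Set X) (Y₀ : Set Y) (φ : X → Y), IsIsoMod0 μ ν X₀ Y₀ φ ∧
    MapsTo T X₀ X₀ ∧ MapsTo S Y₀ Y₀ ∧ ∀ x ∈ X₀, φ (T x) = S (φ x)

/-- The metric of `X` is good for the measure `μ`: open sets are measurable, nonempty open sets
have positive measure, and `μ` is regular. -/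
structure IsGoodMetric {X : Type u} [MeasurableSpace X] [MetricSpace X] (μ : Measure X) :
    Prop where
  measurableSet_of_isOpen : ∀ U : Set X, IsOpen U → MeasurableSet U
  measure_pos : ∀ U : Set X, IsOpen U → U.Nonempty → 0 < μ U
  regular : μ.Regular

/-- Measurable sensitivity of a nonsingular dynamical system `(X, μ, T)`. -/
def IsMeasurablySensitive {X : Type u} [MeasurableSpace X] (μ : Measure X) (T : X → X) : Prop :=
  ∀ (X₁ : Type u) [MeasurableSpace X₁] [MetricSpace X₁] (μ₁ : Measure X₁) (T₁ : X₁ → X₁),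
    IsLebesgueSpace μ₁ → IsNonsingular μ₁ T₁ → AreIsomorphic μ T μ₁ T₁ → IsGoodMetric μ₁ →
    ∃ δ : ℝ, 0 < δ ∧ ∀ (x : X₁) (ε : ℝ), 0 < ε → ∃ N : ℕ, ∀ n : ℕ, N ≤ n →
      0 < μ₁ {y | y ∈ Metric.ball x ε ∧ δ < dist (T₁^[n] x) (T₁^[n] y)}

/-- Light mixing of `T` with respect to a finite measure `μ`. -/
def IsLightlyMixing {X : Type u} [MeasurableSpace X] (μ : Measure X) (T : X → X) : Prop :=
  ∀ A B : Set X, MeasurableSet A → MeasurableSet B → 0 < μ A → 0 < μ B →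
    0 < liminf (fun k : ℕ => μ (T^[k] ⁻¹' A ∩ B)) atTop

end MeasurableSensitivity

/-!
Call `C` a frequent target if the images of some set `B` of positive measure under infinitely many
iterates of `T` lie in `C`.  Measurable sensitivity bounds the measures of frequent targets away
from zero.  Otherwise there are frequent targets of arbitrarily small measure; their tail unions
`U k` decrease to a null set, and one can choose a sequence of sets `F i` disjoint from `U i` that
separates the points outside a null set.  The itinerary map with respect to the `F i` pulls the
metric of the Cantor space back to a good metric in which `U k` is small in diameter, so that any
two points of a suitable `F i` come close together at infinitely many times.

Conversely, suppose that frequent targets are large.  A set of positive measure invariant under a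
power of `T` is a frequent target, so there is such a set of nearly minimal measure; its preimages
under the iterates of `T` split `X` into components on which the return power `S` of `T` is totally
ergodic.  If `S` were not lightly mixing, some `A` of positive measure would be missed by the images
of some `B` of positive measure at infinitely many times.  Let `C` be the complement of `A`, and let
`W x` be the set of points whose orbits lie in `C` whenever the orbit of `x` lies in `B`.  These
sets are frequent targets up to a limit, hence large, and `x ↦ W x` intertwines `S` with an isometry
for the metric `μ (s ∆ t)`.  Balls around the values of this isometric factor are frequent targets
too, so the factor has an atom and total ergodicity makes it trivial: `W x` does not depend on `x`.
It is therefore invariant, hence of full measure, and it is contained in `C` if `x ∈ B`.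
-/

namespace MeasurableSensitivity

open scoped ENNReal Topology symmDiff

/-- The images of some fixed set of positive measure under infinitely many iterates of `T` lie
almost everywhere in `C`.  Measurable sensitivity forces such a `C` to be large. -/
def IsFrequentTarget {X : Type*} [MeasurableSpace X] (μ : Measure X) (T : X → X) (C : Set X) :
    Prop :=
  ∃ B, MeasurableSet B ∧ 0 < μ B ∧ ∃ᶠ k in atTop, B ≤ᵐ[μ] T^[k] ⁻¹' C

/-- The measures of the frequent targets of `T` are bounded away from zero.  This is the only
consequence of measurable sensitivity that the structure theorem needs. -/
def HasLargeFrequentTargets {X : Type*} [MeasurableSpace X] (μ : Measure X) (T : X → X) : Prop :=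
  ∃ c : ℝ≥0∞, 0 < c ∧ ∀ C, MeasurableSet C → IsFrequentTarget μ T C → c ≤ μ C

/-- Total ergodicity: every positive power of `T` is ergodic. -/
def IsTotallyErgodic {X : Type*} [MeasurableSpace X] (μ : Measure X) (T : X → X) : Prop :=
  ∀ n, 1 ≤ n → Ergodic T^[n] μ

section Generic

variable {X : Type*} [MeasurableSpace X] {μ : Measure X}

theorem exists_mem_of_ae {D : Set X} (hD : 0 < μ D) {p : X → Prop} (h : ∀ᵐ x ∂μ, p x) :
    ∃ x ∈ D, p x :=
  ((frequently_ae_mem_iff.2 hD.ne').and_eventually h).exists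

theorem ae_mem_imp_measure_pos (D : Set X) : ∀ᵐ x ∂μ, x ∈ D → 0 < μ D := by
  by_cases h : μ D = 0
  · filter_upwards [measure_eq_zero_iff_ae_notMem.1 h] with x hx hxD using absurd hxD hx
  · exact .of_forall fun _ _ ↦ pos_iff_ne_zero.2 h

theorem ae_eq_comp_of_le_comp {S : X → X} (hS : MeasurePreserving S μ μ) {g : X → ℝ≥0∞}
    (hg : Measurable g) (hfin : ∫⁻ x, g x ∂μ ≠ ∞) (hle : ∀ x, g x ≤ g (S x)) :
    g =ᵐ[μ] g ∘ S :=
  ae_eq_of_ae_le_of_lintegral_le (.of_forall hle) hfin (hg.comp hS.measurable).aemeasurable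
    (hS.lintegral_comp hg).le

theorem le_measure_eq_zero_of_forall_le_measure_lt [IsFiniteMeasure μ] {g : X → ℝ≥0∞}
    (hg : Measurable g) {c : ℝ≥0∞} (h : ∀ ε, 0 < ε → c ≤ μ {x | g x < ε}) :
    c ≤ μ {x | g x = 0} := by
  have hinter : {x | g x = 0} = ⋂ ε > 0, {x | g x < ε} := by
    ext x
    simpa [pos_iff_ne_zero] using
      (⟨fun h ε hε ↦ h ▸ pos_iff_ne_zero.2 hε, fun h ↦ by_contra fun h0 ↦ (h _ h0).false⟩ :
        g x = 0 ↔ ∀ ε, ε ≠ 0 → g x < ε)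
  rw [hinter]
  refine ge_of_tendsto (tendsto_measure_biInter_gt
    (fun ε _ ↦ (measurableSet_lt hg measurable_const).nullMeasurableSet)
    (fun _ _ _ hle x hx ↦ lt_of_lt_of_le hx hle) ⟨1, one_pos, measure_ne_top _ _⟩) ?_
  filter_upwards [self_mem_nhdsWithin] with ε hε using h ε hε

end Generic

section IsometricFactor

variable {X P : Type*} [MeasurableSpace X] {μ : Measure X} [PseudoEMetricSpace P] {S : X → X}
  {f : X → P}

theorem ae_forall_measure_edist_lt_pos (hf : TopologicalSpace.IsSeparable (range f)) :
    ∀ᵐ x ∂μ, ∀ ε, 0 < ε → 0 < μ {z | edist (f z) (f x) < ε} := by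
  obtain ⟨t, ht, hrange⟩ := hf
  have : Countable t := ht.to_subtype
  have hpos : ∀ᵐ x ∂μ, ∀ (p : t) (m : ℕ), x ∈ {z | edist (f z) p < (m : ℝ≥0∞)⁻¹} →
      0 < μ {z | edist (f z) p < (m : ℝ≥0∞)⁻¹} :=
    ae_all_iff.2 fun p ↦ ae_all_iff.2 fun m ↦ ae_mem_imp_measure_pos _
  filter_upwards [hpos] with x hx ε hε
  obtain ⟨m, hm⟩ := ENNReal.exists_inv_nat_lt (ENNReal.half_pos hε.ne').ne'
  obtain ⟨p, hpt, hp⟩ := EMetric.mem_closure_iff.1 (hrange (mem_range_self x)) (m : ℝ≥0∞)⁻¹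
    (by simp)
  refine (hx ⟨p, hpt⟩ m hp).trans_le (measure_mono fun z (hz : edist (f z) p < _) ↦ ?_)
  calc edist (f z) (f x) ≤ edist (f z) p + edist (f x) p := edist_triangle_right _ _ _
    _ < ε / 2 + ε / 2 := ENNReal.add_lt_add (hz.trans hm) (hp.trans hm)
    _ = ε := ENNReal.add_halves ε

theorem ae_forall_edist_iterate_eq (hS : Measure.QuasiMeasurePreserving S μ μ)
    (hiso : ∀ᵐ x ∂μ, ∀ᵐ z ∂μ, edist (f (S x)) (f (S z)) = edist (f x) (f z)) :
    ∀ᵐ x ∂μ, ∀ᵐ z ∂μ, ∀ n, edist (f (S^[n] x)) (f (S^[n] z)) = edist (f x) (f z) := by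
  simp only [ae_all_iff]
  intro n
  induction n with
  | zero => exact .of_forall fun _ ↦ .of_forall fun _ ↦ rfl
  | succ n ih =>
    filter_upwards [ih, (hS.iterate n).ae hiso] with x hx hx'
    filter_upwards [hx, (hS.iterate n).ae hx'] with z hz hz'
    rw [Function.iterate_succ_apply', Function.iterate_succ_apply', hz', hz]

theorem edist_le_add_of_edist_eq {a b a' b' : P} (h : edist b' a' = edist b a) (p : P) :
    edist a' p ≤ edist a p + edist b p + edist b' p :=
  calc edist a' p ≤ edist b' a' + edist b' p := by
        rw [edist_comm b']; exact edist_triangle _ _ _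
    _ ≤ edist a p + edist b p + edist b' p := by
        rw [h, add_comm (edist a p)]; gcongr; exact edist_triangle_right _ _ _

theorem isFrequentTarget_edist_lt [IsFiniteMeasure μ] (hS : MeasurePreserving S μ μ)
    (hf : StronglyMeasurable f)
    (hiso : ∀ᵐ x ∂μ, ∀ᵐ z ∂μ, edist (f (S x)) (f (S z)) = edist (f x) (f z)) {p : P} {ε : ℝ≥0∞}
    (hpos : 0 < μ {z | edist (f z) p < ε / 3}) : IsFrequentTarget μ S {z | edist (f z) p < ε} := by
  have hm : MeasurableSet {z | edist (f z) p < ε / 3} :=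
    measurableSet_lt (hf.edist stronglyMeasurable_const).measurable measurable_const
  refine ⟨_, hm, hpos, ?_⟩
  obtain ⟨x, hxp, hx, hrec⟩ := exists_mem_of_ae hpos
    ((ae_forall_edist_iterate_eq hS.quasiMeasurePreserving hiso).and
      (hS.conservative.ae_mem_imp_frequently_image_mem hm.nullMeasurableSet))
  refine (hrec hxp).mono fun n hn ↦ ?_
  filter_upwards [hx] with z hz hzp
  calc edist (f (S^[n] z)) p
      ≤ edist (f z) p + edist (f x) p + edist (f (S^[n] x)) p := edist_le_add_of_edist_eq (hz n) p
    _ < ε / 3 + ε / 3 + ε / 3 := ENNReal.add_lt_add (ENNReal.add_lt_add hzp hxp) hn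
    _ = ε := ENNReal.add_thirds ε

theorem exists_ae_le_preimage_iterate_edist_eq_zero [IsFiniteMeasure μ]
    (hS : MeasurePreserving S μ μ) (hf : StronglyMeasurable f)
    (hiso : ∀ᵐ x ∂μ, ∀ᵐ z ∂μ, edist (f (S x)) (f (S z)) = edist (f x) (f z)) {p : P}
    (hpos : 0 < μ {z | edist (f z) p = 0}) :
    ∃ n, 1 ≤ n ∧ {z | edist (f z) p = 0} ≤ᵐ[μ] S^[n] ⁻¹' {z | edist (f z) p = 0} := by
  have hm : MeasurableSet {z | edist (f z) p = 0} :=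
    (hf.edist stronglyMeasurable_const).measurable (measurableSet_singleton 0)
  obtain ⟨x, hxp, hx, hrec⟩ := exists_mem_of_ae hpos
    ((ae_forall_edist_iterate_eq hS.quasiMeasurePreserving hiso).and
      (hS.conservative.ae_mem_imp_frequently_image_mem hm.nullMeasurableSet))
  obtain ⟨n, hn, hnp⟩ := frequently_atTop.1 (hrec hxp) 1
  refine ⟨n, hn, ?_⟩
  filter_upwards [hx] with z hz (hzp : edist (f z) p = 0)
  refine le_antisymm ((edist_le_add_of_edist_eq (hz n) p).trans_eq ?_) bot_le
  rw [hzp, hxp, hnp, add_zero, add_zero]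

theorem IsTotallyErgodic.ae_edist_eq_zero [IsFiniteMeasure μ] (hS : IsTotallyErgodic μ S)
    (hlarge : HasLargeFrequentTargets μ S) (hf : StronglyMeasurable f)
    (hiso : ∀ᵐ x ∂μ, ∀ᵐ z ∂μ, edist (f (S x)) (f (S z)) = edist (f x) (f z)) :
    ∀ᵐ x ∂μ, ∀ᵐ z ∂μ, edist (f z) (f x) = 0 := by
  obtain ⟨c, hc, hlarge⟩ := hlarge
  have hSm : MeasurePreserving S μ μ := (hS 1 le_rfl).toMeasurePreserving
  filter_upwards [ae_forall_measure_edist_lt_pos hf.isSeparable_range] with x hx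
  have hdist : Measurable fun z ↦ edist (f z) (f x) :=
    (hf.edist stronglyMeasurable_const).measurable
  have hzero : 0 < μ {z | edist (f z) (f x) = 0} :=
    hc.trans_le <| le_measure_eq_zero_of_forall_le_measure_lt hdist fun ε hε ↦
      hlarge _ (measurableSet_lt hdist measurable_const) <| isFrequentTarget_edist_lt hSm hf hiso <|
        hx _ (ENNReal.div_pos hε.ne' (by simp))
  obtain ⟨n, hn, hle⟩ := exists_ae_le_preimage_iterate_edist_eq_zero hSm hf hiso hzero
  refine (((hS n hn).ae_empty_or_univ_of_ae_le_preimage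
    (hdist (measurableSet_singleton 0)).nullMeasurableSet hle).resolve_left fun h ↦ ?_).mem_iff.mono
    fun z hz ↦ hz.2 trivial
  exact hzero.ne' (ae_eq_empty.1 h)

end IsometricFactor

section Visiting

/-- The times at which the orbit of `x` under `S` lies in `B`. -/
def visitTimes {X : Type*} (S : X → X) (B : Set X) (x : X) : Set ℕ :=
  {j | S^[j] x ∈ B}

/-- The points whose orbits under `S` lie in `C` at all the times in `F`.  With `F` the visit times
of `x` to another set `B`, this set depends equivariantly on `x`, up to null sets. -/
def visiting {X : Type*} (S : X → X) (C : Set X) (F : Set ℕ) : Set X :=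
  ⋂ j ∈ F, S^[j] ⁻¹' C

theorem mem_visiting {X : Type*} {S : X → X} {C : Set X} {F : Set ℕ} {y : X} :
    y ∈ visiting S C F ↔ ∀ j ∈ F, S^[j] y ∈ C := by
  simp only [visiting, mem_iInter, mem_preimage]

theorem visiting_visitTimes_subset_preimage {X : Type*} (S : X → X) (B C : Set X) (x : X) :
    visiting S C (visitTimes S B x) ⊆ S ⁻¹' visiting S C (visitTimes S B (S x)) := fun _ hy ↦
  mem_visiting.2 fun j hj ↦ mem_visiting.1 hy (j + 1) hj

variable {X : Type*} [MeasurableSpace X] {μ : Measure X} {S : X → X} {B C : Set X}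

theorem measurableSet_visiting (hS : Measurable S) (hC : MeasurableSet C) (F : Set ℕ) :
    MeasurableSet (visiting S C F) :=
  .biInter (to_countable F) fun j _ ↦ hS.iterate j hC

/-- `visiting S C F` as a point of the space of measurable sets, in which two sets are at distance
`μ (s ∆ t)`. -/
def measuredVisiting (μ : Measure X) (hS : Measurable S) (hC : MeasurableSet C) (F : Set ℕ) :
    MeasuredSets μ :=
  ⟨visiting S C F, measurableSet_visiting hS hC F⟩

theorem measurable_visitTimes (hS : Measurable S) (hB : MeasurableSet B) :
    Measurable (visitTimes S B) :=
  measurable_set_iff.2 fun j ↦ (measurable_mem (s := B)).2 hB |>.comp (hS.iterate j)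

theorem isFrequentTarget_visiting (hS : Measurable S) (hB : MeasurableSet B)
    (hBC : ∃ᶠ k in atTop, B ⊆ S^[k] ⁻¹' C) {F : Set ℕ} (hF : 0 < μ (visiting S B F)) :
    IsFrequentTarget μ S (visiting S C F) := by
  refine ⟨_, measurableSet_visiting hS hB F, hF, hBC.mono fun k hk ↦ .of_forall fun y hy ↦ ?_⟩
  refine mem_visiting.2 fun j hj ↦ ?_
  rw [← Function.iterate_add_apply, add_comm, Function.iterate_add_apply]
  exact hk (mem_visiting.1 hy j hj)

theorem stronglyMeasurable_of_tendsto_inter_Iio {P : Type*} [TopologicalSpace P]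
    [TopologicalSpace.PseudoMetrizableSpace P] {W : Set ℕ → P}
    (hW : ∀ F, Tendsto (fun N ↦ W (F ∩ Iio N)) atTop (𝓝 (W F))) : StronglyMeasurable W := by
  refine stronglyMeasurable_of_tendsto atTop (fun N ↦ ?_) (tendsto_pi_nhds.2 hW)
  let g : (Iio N → Prop) → P := fun G ↦ W {j | ∃ h, G ⟨j, h⟩}
  have hg : (fun F : Set ℕ ↦ W (F ∩ Iio N)) = g ∘ fun F j ↦ (j : ℕ) ∈ F := by
    ext F
    simp only [g, Function.comp_apply]
    congr 1
    ext j
    simp [and_comm]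
  rw [hg]
  exact StronglyMeasurable.of_discrete.comp_measurable
    (measurable_pi_iff.2 fun j ↦ measurable_set_mem (j : ℕ))

theorem tendsto_visiting_inter_Iio [IsFiniteMeasure μ] (hS : Measurable S) (hC : MeasurableSet C)
    (F : Set ℕ) :
    Tendsto (fun N ↦ measuredVisiting μ hS hC (F ∩ Iio N)) atTop
      (𝓝 (measuredVisiting μ hS hC F)) := by
  suffices Tendsto (fun N ↦ μ (visiting S C (F ∩ Iio N) ∆ visiting S C F)) atTop (𝓝 0) from
    tendsto_iff_edist_tendsto_0.2 this
  have hsub : ∀ N, visiting S C F ⊆ visiting S C (F ∩ Iio N) := fun N ↦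
    biInter_subset_biInter_left inter_subset_left
  have hinter : ⋂ N, visiting S C (F ∩ Iio N) \ visiting S C F = ∅ :=
    eq_empty_of_forall_notMem fun y hy ↦ (mem_iInter.1 hy 0).2 <| mem_visiting.2 fun j hj ↦
      mem_visiting.1 (mem_iInter.1 hy (j + 1)).1 j ⟨hj, j.lt_succ_self⟩
  simp only [symmDiff_of_ge (hsub _)]
  rw [← measure_empty (μ := μ), ← hinter]
  refine tendsto_measure_iInter_atTop (fun N ↦ ((measurableSet_visiting hS hC _).diff
    (measurableSet_visiting hS hC _)).nullMeasurableSet) (fun M N hMN ↦ ?_) ⟨0, measure_ne_top _ _⟩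
  exact sdiff_subset_sdiff_left <| biInter_subset_biInter_left <|
    inter_subset_inter_right F (Iio_subset_Iio hMN)

theorem stronglyMeasurable_visiting [IsFiniteMeasure μ] (hS : Measurable S)
    (hB : MeasurableSet B) (hC : MeasurableSet C) :
    StronglyMeasurable fun x ↦ measuredVisiting μ hS hC (visitTimes S B x) :=
  (stronglyMeasurable_of_tendsto_inter_Iio (tendsto_visiting_inter_Iio hS hC)).comp_measurable
    (measurable_visitTimes hS hB)

theorem ae_le_measure_visiting [IsFiniteMeasure μ] (hS : Measurable S) (hB : MeasurableSet B)
    (hC : MeasurableSet C) (hBC : ∃ᶠ k in atTop, B ⊆ S^[k] ⁻¹' C) {c : ℝ≥0∞}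
    (hc : ∀ C, MeasurableSet C → IsFrequentTarget μ S C → c ≤ μ C) :
    ∀ᵐ x ∂μ, c ≤ μ (visiting S C (visitTimes S B x)) := by
  have hpos : ∀ᵐ x ∂μ, ∀ F : Finset ℕ, x ∈ visiting S B F → 0 < μ (visiting S B F) :=
    ae_all_iff.2 fun _ ↦ ae_mem_imp_measure_pos _
  filter_upwards [hpos] with x hx
  refine ge_of_tendsto' ((MeasuredSets.continuous_measure.tendsto _).comp
    (tendsto_visiting_inter_Iio hS hC (visitTimes S B x))) fun N ↦
      hc _ (measurableSet_visiting hS hC _) (isFrequentTarget_visiting hS hB hBC ?_)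
  have hfin : (visitTimes S B x ∩ Iio N).Finite := (finite_Iio N).inter_of_right _
  rw [← hfin.coe_toFinset]
  exact hx _ (mem_visiting.2 fun j hj ↦ ((hfin.coe_toFinset.subset hj).1))

theorem ae_visiting_visitTimes_ae_eq_preimage [IsFiniteMeasure μ] (hS : MeasurePreserving S μ μ)
    (hB : MeasurableSet B) (hC : MeasurableSet C) :
    ∀ᵐ x ∂μ, visiting S C (visitTimes S B x) =ᵐ[μ]
      S ⁻¹' visiting S C (visitTimes S B (S x)) := by
  have hm (x : X) : NullMeasurableSet (visiting S C (visitTimes S B x)) μ :=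
    (measurableSet_visiting hS.measurable hC _).nullMeasurableSet
  have hmeas : Measurable fun x ↦ μ (visiting S C (visitTimes S B x)) :=
    (MeasuredSets.continuous_measure.comp_stronglyMeasurable
      (stronglyMeasurable_visiting hS.measurable hB hC)).measurable
  have hfin : ∫⁻ x, μ (visiting S C (visitTimes S B x)) ∂μ ≠ ∞ :=
    ((lintegral_mono fun x ↦ measure_mono (subset_univ _)).trans_lt
      (by simpa using ENNReal.mul_lt_top (measure_lt_top μ univ) (measure_lt_top μ univ))).ne
  have hsub := visiting_visitTimes_subset_preimage S B C
  filter_upwards [ae_eq_comp_of_le_comp hS hmeas hfin fun x ↦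
    (measure_mono (hsub x)).trans_eq (hS.measure_preimage (hm _))] with x hx
  exact ae_eq_of_subset_of_measure_ge (hsub x) ((hS.measure_preimage (hm _)).trans hx.symm).le
    (hm x) (measure_ne_top _ _)

theorem IsTotallyErgodic.measure_compl_eq_zero [IsFiniteMeasure μ] (hS : IsTotallyErgodic μ S)
    (hlarge : HasLargeFrequentTargets μ S) (hB : MeasurableSet B) (hB0 : 0 < μ B)
    (hC : MeasurableSet C) (hBC : ∃ᶠ k in atTop, B ⊆ S^[k] ⁻¹' C) : μ Cᶜ = 0 := by
  have hSe : Ergodic S μ := hS 1 le_rfl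
  have hqmp := hSe.toMeasurePreserving.quasiMeasurePreserving
  obtain ⟨c, hc, hle⟩ := hlarge
  have hequiv := ae_visiting_visitTimes_ae_eq_preimage hSe.toMeasurePreserving hB hC
  have hiso : ∀ᵐ x ∂μ, ∀ᵐ z ∂μ,
      μ (visiting S C (visitTimes S B (S x)) ∆ visiting S C (visitTimes S B (S z))) =
        μ (visiting S C (visitTimes S B x) ∆ visiting S C (visitTimes S B z)) := by
    filter_upwards [hequiv] with x hx
    filter_upwards [hequiv] with z hz
    rw [measure_congr (hx.symmDiff hz), ← preimage_symmDiff,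
      hSe.measure_preimage (((measurableSet_visiting hSe.measurable hC _).symmDiff
        (measurableSet_visiting hSe.measurable hC _)).nullMeasurableSet)]
  have hconst : ∀ᵐ x ∂μ, ∀ᵐ z ∂μ,
      visiting S C (visitTimes S B z) =ᵐ[μ] visiting S C (visitTimes S B x) :=
    (hS.ae_edist_eq_zero ⟨c, hc, hle⟩ (stronglyMeasurable_visiting hSe.measurable hB hC)
      hiso).mono fun x hx ↦ hx.mono fun z hz ↦ measure_symmDiff_eq_zero_iff.1 hz
  obtain ⟨x₀, -, hx₀⟩ := exists_mem_of_ae hB0 hconst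
  obtain ⟨x, hxB, hxle, hxequiv, hx, hSx⟩ := exists_mem_of_ae hB0
    ((ae_le_measure_visiting hSe.measurable hB hC hBC hle).and
      (hequiv.and (hx₀.and (hqmp.ae hx₀))))
  have hinv : S ⁻¹' visiting S C (visitTimes S B x) =ᵐ[μ] visiting S C (visitTimes S B x) :=
    (hqmp.preimage_ae_eq (hx.trans hSx.symm)).trans hxequiv.symm
  have hfull : visiting S C (visitTimes S B x) =ᵐ[μ] univ :=
    (hSe.quasiErgodic.ae_empty_or_univ₀
      (measurableSet_visiting hSe.measurable hC _).nullMeasurableSet hinv).resolve_left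
        fun h ↦ (hc.trans_le hxle).ne' (ae_eq_empty.1 h)
  exact measure_mono_null (compl_subset_compl.2 fun y hy ↦ mem_visiting.1 hy 0 hxB)
    (ae_eq_univ.1 hfull)

end Visiting

section LightMixing

variable {X : Type*} [MeasurableSpace X] {μ : Measure X} {S : X → X}

theorem exists_frequently_subset_preimage_compl (hS : Measurable S) {A B : Set X}
    (hA : MeasurableSet A) (hB : MeasurableSet B) (hB0 : 0 < μ B)
    (h : liminf (fun k : ℕ ↦ μ (S^[k] ⁻¹' A ∩ B)) atTop = 0) :
    ∃ B', MeasurableSet B' ∧ 0 < μ B' ∧ ∃ᶠ k in atTop, B' ⊆ S^[k] ⁻¹' Aᶜ := by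
  obtain ⟨ε, hε, hsum⟩ := ENNReal.exists_pos_sum_of_countable hB0.ne' ℕ
  have hk : ∀ i : ℕ, ∃ k, i ≤ k ∧ μ (S^[k] ⁻¹' A ∩ B) < ε i := fun i ↦
    frequently_atTop.1 (frequently_lt_of_liminf_lt (by isBoundedDefault)
      (h.trans_lt (ENNReal.coe_pos.2 (hε i)))) i
  choose k hik hk using hk
  have hsmall : μ (⋃ i, S^[k i] ⁻¹' A ∩ B) < μ B :=
    ((measure_iUnion_le _).trans (ENNReal.tsum_le_tsum fun i ↦ (hk i).le)).trans_lt hsum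
  have hm : MeasurableSet (⋃ i, S^[k i] ⁻¹' A ∩ B) := .iUnion fun i ↦ (hS.iterate _ hA).inter hB
  exact ⟨B \ ⋃ i, S^[k i] ⁻¹' A ∩ B, hB.diff hm,
    (tsub_pos_of_lt hsmall).trans_le le_measure_sdiff, frequently_atTop.2 fun i ↦
      ⟨k i, hik i, fun x hx hxA ↦ hx.2 (mem_iUnion.2 ⟨i, hxA, hx.1⟩)⟩⟩

theorem IsTotallyErgodic.isLightlyMixing [IsFiniteMeasure μ] (hS : IsTotallyErgodic μ S)
    (hlarge : HasLargeFrequentTargets μ S) : IsLightlyMixing μ S := by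
  intro A B hA hB hA0 hB0
  refine pos_iff_ne_zero.2 fun h0 ↦ hA0.ne' ?_
  obtain ⟨B', hB', hB'0, hfreq⟩ :=
    exists_frequently_subset_preimage_compl (hS 1 le_rfl).measurable hA hB hB0 h0
  simpa only [compl_compl] using hS.measure_compl_eq_zero hlarge hB' hB'0 hA.compl hfreq

end LightMixing

section CyclicDecomposition

/-- A measurable set of positive measure that is strictly invariant under the positive power
`T^[n]`. -/
structure IsPeriodicSet {X : Type*} [MeasurableSpace X] (μ : Measure X) (T : X → X) (n : ℕ)
    (E : Set X) : Prop where
  one_le : 1 ≤ n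
  measurableSet : MeasurableSet E
  measure_pos : 0 < μ E
  preimage_eq : T^[n] ⁻¹' E = E

theorem preimage_iterate_comm {X : Type*} {T : X → X} (i j : ℕ) (E : Set X) :
    T^[i] ⁻¹' (T^[j] ⁻¹' E) = T^[j] ⁻¹' (T^[i] ⁻¹' E) := by
  simp only [← preimage_comp, ← Function.iterate_add, add_comm]

theorem preimage_iterate_mul_eq {X : Type*} {T : X → X} {n : ℕ} {E : Set X}
    (h : T^[n] ⁻¹' E = E) (m : ℕ) : T^[n * m] ⁻¹' E = E := by
  rw [Function.iterate_mul, Set.preimage_iterate_eq]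
  exact Function.iterate_fixed h m

variable {X : Type*} [MeasurableSpace X] {μ : Measure X} {T : X → X} {n : ℕ} {D E : Set X}

theorem IsPeriodicSet.isFrequentTarget (hE : IsPeriodicSet μ T n E) : IsFrequentTarget μ T E :=
  ⟨E, hE.measurableSet, hE.measure_pos, frequently_atTop.2 fun N ↦
    ⟨n * N, Nat.le_mul_of_pos_left N hE.one_le,
      (preimage_iterate_mul_eq hE.preimage_eq N).symm.eventuallyEq.le⟩⟩

theorem IsPeriodicSet.preimage_iterate (hE : IsPeriodicSet μ T n E) (hT : MeasurePreserving T μ μ)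
    (i : ℕ) : IsPeriodicSet μ T n (T^[i] ⁻¹' E) where
  one_le := hE.one_le
  measurableSet := (hT.iterate i).measurable hE.measurableSet
  measure_pos := by
    rw [(hT.iterate i).measure_preimage hE.measurableSet.nullMeasurableSet]
    exact hE.measure_pos
  preimage_eq := by rw [preimage_iterate_comm, hE.preimage_eq]

theorem HasLargeFrequentTargets.restrict_iterate (h : HasLargeFrequentTargets μ T)
    (hD : IsPeriodicSet μ T n D) : HasLargeFrequentTargets (μ.restrict D) T^[n] := by
  obtain ⟨c, hc, h⟩ := h
  refine ⟨c, hc, fun C hC ⟨B, hB, hB0, hfreq⟩ ↦ ?_⟩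
  rw [Measure.restrict_apply hB] at hB0
  rw [Measure.restrict_apply hC]
  refine h _ (hC.inter hD.measurableSet) ⟨_, hB.inter hD.measurableSet, hB0,
    frequently_atTop.2 fun N ↦ ?_⟩
  obtain ⟨k, hNk, hk⟩ := frequently_atTop.1 hfreq N
  refine ⟨n * k, hNk.trans (Nat.le_mul_of_pos_left k hD.one_le), ?_⟩
  filter_upwards [(ae_restrict_iff' hD.measurableSet).1 hk] with x hx hxBD
  have hxC : (T^[n])^[k] x ∈ C := hx hxBD.2 hxBD.1
  exact ⟨by rwa [← Function.iterate_mul] at hxC,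
    (preimage_iterate_mul_eq hD.preimage_eq k).ge hxBD.2⟩

theorem exists_isPeriodicSet_measure_lt_add_self [IsFiniteMeasure μ] (hμ : μ ≠ 0)
    (h : HasLargeFrequentTargets μ T) :
    ∃ r, (∀ n E, IsPeriodicSet μ T n E → r ≤ μ E) ∧ ∃ n D, IsPeriodicSet μ T n D ∧ μ D < r + r := by
  obtain ⟨c, hc, hle⟩ := h
  set I : Set ℝ≥0∞ := {r | ∃ n E, IsPeriodicSet μ T n E ∧ μ E = r}
  have hcI : c ≤ sInf I := le_sInf fun r ⟨n, E, hE, hr⟩ ↦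
    hr ▸ hle E hE.measurableSet hE.isFrequentTarget
  have huniv : μ univ ∈ I :=
    ⟨1, univ, ⟨le_rfl, .univ, Measure.measure_univ_pos.2 hμ, preimage_univ⟩, rfl⟩
  have hfin : sInf I ≠ ∞ := ((sInf_le huniv).trans_lt (measure_lt_top _ _)).ne
  obtain ⟨_, ⟨n, D, hD, rfl⟩, hDlt⟩ :=
    sInf_lt_iff.1 (ENNReal.lt_add_right hfin (hc.trans_le hcI).ne')
  exact ⟨sInf I, fun n E hE ↦ sInf_le ⟨n, E, hE, rfl⟩, n, D, hD, hDlt⟩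

theorem IsPeriodicSet.isTotallyErgodic [IsFiniteMeasure μ] (hT : MeasurePreserving T μ μ)
    (hD : IsPeriodicSet μ T n D) {r : ℝ≥0∞} (hr : ∀ n E, IsPeriodicSet μ T n E → r ≤ μ E)
    (hlt : μ D < r + r) : IsTotallyErgodic (μ.restrict D) T^[n] := by
  intro m hm
  have hTD : MeasurePreserving T^[n] (μ.restrict D) (μ.restrict D) := by
    simpa only [hD.preimage_eq] using (hT.iterate n).restrict_preimage hD.measurableSet
  refine ⟨hTD.iterate m, ⟨fun s hs hsinv ↦ ?_⟩⟩
  rw [← Function.iterate_mul] at hsinv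
  have hDinv := preimage_iterate_mul_eq hD.preimage_eq m
  have hnm : 1 ≤ n * m := Nat.mul_pos hD.one_le hm
  have hsplit : μ (D ∩ s) = 0 ∨ μ (D \ s) = 0 := by
    by_contra! hpos
    refine hlt.not_ge ((add_le_add (hr (n * m) (D ∩ s) ?_) (hr (n * m) (D \ s) ?_)).trans_eq
      (measure_inter_add_sdiff D hs))
    · exact ⟨hnm, hD.measurableSet.inter hs, pos_iff_ne_zero.2 hpos.1,
        by rw [preimage_inter, hDinv, hsinv]⟩
    · exact ⟨hnm, hD.measurableSet.diff hs, pos_iff_ne_zero.2 hpos.2,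
        by rw [preimage_sdiff, hDinv, hsinv]⟩
  refine eventuallyConst_set'.2 (hsplit.imp (fun h ↦ ae_eq_empty.2 ?_) fun h ↦ ae_eq_univ.2 ?_)
  · rwa [Measure.restrict_apply hs, inter_comm]
  · rwa [Measure.restrict_apply hs.compl, inter_comm]

theorem IsPeriodicSet.measure_inter_preimage_iterate_eq_zero [IsFiniteMeasure μ]
    (hT : MeasurePreserving T μ μ) (hD : IsPeriodicSet μ T n D)
    (herg : IsTotallyErgodic (μ.restrict D) T^[n]) {j : ℕ} (hj : 1 ≤ j)
    (hmin : ∀ E, IsPeriodicSet μ T j E → μ E ≠ μ D) : μ (D ∩ T^[j] ⁻¹' D) = 0 := by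
  have hDm := hD.measurableSet
  have hDj := (hT.iterate j).measurable hDm
  by_contra hpos
  have hsub : D ≤ᵐ[μ] T^[j] ⁻¹' D := by
    refine (ae_restrict_iff' hDm).1 (eventuallyEq_univ.1 <|
      ((herg 1 le_rfl).quasiErgodic.ae_empty_or_univ₀ hDj.nullMeasurableSet ?_).resolve_left
        fun h ↦ hpos ?_)
    · exact (hD.preimage_iterate hT j).preimage_eq.eventuallyEq
    · rw [inter_comm, ← Measure.restrict_apply hDj]
      exact ae_eq_empty.1 h
  have hinv : T^[j] ⁻¹' D =ᵐ[μ] D :=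
    (ae_eq_of_ae_subset_of_measure_ge hsub
      ((hT.iterate j).measure_preimage hDm.nullMeasurableSet).le hDm.nullMeasurableSet
      (measure_ne_top _ _)).symm
  obtain ⟨E, hE, hED, hEj⟩ :=
    (hT.iterate j).quasiMeasurePreserving.exists_preimage_eq_of_preimage_ae
      hDm.nullMeasurableSet hinv
  exact hmin E ⟨hj, hE, (measure_congr hED).symm ▸ hD.measure_pos, hEj⟩ (measure_congr hED)

theorem IsPeriodicSet.exists_pairwise_disjoint (hT : Measurable T) (hD : IsPeriodicSet μ T n D)
    (hnull : ∀ j, 1 ≤ j → j < n → μ (D ∩ T^[j] ⁻¹' D) = 0) :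
    ∃ E, IsPeriodicSet μ T n E ∧ E =ᵐ[μ] D ∧
      Pairwise (Function.onFun Disjoint fun i : Fin n ↦ T^[i] ⁻¹' E) := by
  set U := ⋃ j ∈ Ico 1 n, T^[j] ⁻¹' D with hU
  have hUm : MeasurableSet U :=
    .biUnion (to_countable _) fun j _ ↦ hT.iterate j hD.measurableSet
  have hDU : μ (D ∩ U) = 0 := by
    rw [hU, inter_iUnion₂]
    exact (measure_biUnion_null_iff (to_countable _)).2 fun j hj ↦ hnull j hj.1 hj.2
  have hED : (D \ U : Set X) =ᵐ[μ] D := sdiff_ae_eq_self.2 hDU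
  have hinv : T^[n] ⁻¹' (D \ U) = D \ U := by
    simp only [hU, preimage_sdiff, preimage_iUnion, preimage_iterate_comm n, hD.preimage_eq]
  have hdisj : ∀ i j : Fin n, i < j → Disjoint (T^[i] ⁻¹' (D \ U)) (T^[j] ⁻¹' (D \ U)) := by
    intro i j hij
    refine disjoint_left.2 fun x hxi hxj ↦ hxi.2 (mem_iUnion₂.2 ⟨j - i, by simp; omega, ?_⟩)
    rw [mem_preimage, ← Function.iterate_add_apply, Nat.sub_add_cancel hij.le]
    exact hxj.1
  refine ⟨D \ U, ⟨hD.one_le, hD.measurableSet.diff hUm, (measure_congr hED).symm ▸ hD.measure_pos,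
    hinv⟩, hED, fun i j hij ↦ ?_⟩
  exact hij.lt_or_gt.elim (hdisj i j) fun h ↦ (hdisj j i h).symm

theorem IsPeriodicSet.measure_compl_iUnion_preimage_eq_zero [IsFiniteMeasure μ] (hT : Ergodic T μ)
    (hE : IsPeriodicSet μ T n E) : μ (⋃ i : Fin n, T^[i] ⁻¹' E)ᶜ = 0 := by
  have hsub : T ⁻¹' (⋃ i : Fin n, T^[i] ⁻¹' E) ⊆ ⋃ i : Fin n, T^[i] ⁻¹' E := by
    intro x hx
    obtain ⟨i, hi⟩ := mem_iUnion.1 hx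
    rw [mem_preimage, ← Function.iterate_succ_apply] at hi
    rcases (Nat.succ_le_of_lt i.2).lt_or_eq with hlt | heq
    · exact mem_iUnion.2 ⟨⟨_, hlt⟩, hi⟩
    · exact mem_iUnion.2 ⟨⟨0, hE.one_le⟩, hE.preimage_eq.le (heq ▸ hi)⟩
  have hm : MeasurableSet (⋃ i : Fin n, T^[i] ⁻¹' E) :=
    .iUnion fun i ↦ (hE.preimage_iterate hT.toMeasurePreserving i).measurableSet
  refine ae_eq_univ.1 <| (hT.ae_empty_or_univ_of_preimage_ae_le hm.nullMeasurableSet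
    (.of_forall hsub)).resolve_left fun h ↦ hE.measure_pos.ne' ?_
  exact measure_mono_null (subset_iUnion (fun i : Fin n ↦ T^[i] ⁻¹' E) ⟨0, hE.one_le⟩)
    (ae_eq_empty.1 h)

theorem exists_cyclic_decomposition [IsFiniteMeasure μ] (hμ : μ ≠ 0) (hT : Ergodic T μ)
    (hlarge : HasLargeFrequentTargets μ T) :
    ∃ n, 1 ≤ n ∧ ∃ A : Fin n → Set X, (∀ i, IsPeriodicSet μ T n (A i)) ∧
      Pairwise (Function.onFun Disjoint A) ∧ μ (⋃ i, A i)ᶜ = 0 ∧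
      ∀ i, IsTotallyErgodic (μ.restrict (A i)) T^[n] := by
  classical
  have hTm := hT.toMeasurePreserving
  obtain ⟨r, hr, hex⟩ := exists_isPeriodicSet_measure_lt_add_self hμ hlarge
  obtain ⟨D, hD, hDlt⟩ := Nat.find_spec hex
  have hmin := fun j ↦ Nat.find_min (H := hex) (m := j)
  set n := Nat.find hex
  obtain ⟨E, hE, hED, hdisj⟩ := hD.exists_pairwise_disjoint hTm.measurable fun j hj hjn ↦
    hD.measure_inter_preimage_iterate_eq_zero hTm (hD.isTotallyErgodic hTm hr hDlt) hj
      fun F hF hFD ↦ hmin j hjn ⟨F, hF, hFD.trans_lt hDlt⟩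
  refine ⟨n, hE.one_le, fun i ↦ T^[i] ⁻¹' E, fun i ↦ hE.preimage_iterate hTm i, hdisj,
    hE.measure_compl_iUnion_preimage_eq_zero hT, fun i ↦
      (hE.preimage_iterate hTm i).isTotallyErgodic hTm hr ?_⟩
  rwa [(hTm.iterate i).measure_preimage hE.measurableSet.nullMeasurableSet, measure_congr hED]

end CyclicDecomposition

section Regularity

theorem exists_subset_measurableSet_image {Y Z : Type*} [MeasurableSpace Y] [StandardBorelSpace Y]
    [MeasurableSpace Z] [MeasurableSpace.CountablySeparated Z] {ν : Measure Y} {g : Y → Z}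
    (hg : AEMeasurable g ν) {P : Set Y} (hP : NullMeasurableSet P ν) (hinj : InjOn g P) :
    ∃ R ⊆ P, MeasurableSet (g '' R) ∧ ν (P \ R) = 0 := by
  have hs : NullMeasurableSet {t | g t = hg.mk g t} ν :=
    nullMeasurableSet_univ.congr (ae_eq_univ.2 hg.ae_eq_mk).symm
  obtain ⟨R, hRsub, hR, hRae⟩ := (hP.inter hs).exists_measurable_subset_ae_eq
  have hRmk : EqOn g (hg.mk g) R := fun t ht ↦ (hRsub ht).2
  have hRP : R ⊆ P := hRsub.trans inter_subset_left
  refine ⟨R, hRP, ?_, ?_⟩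
  · rw [hRmk.image_eq]
    exact hR.image_of_measurable_injOn hg.measurable_mk ((hinj.mono hRP).congr hRmk)
  · refine measure_mono_null (t := {t | g t = hg.mk g t}ᶜ ∪ (P ∩ {t | g t = hg.mk g t}) \ R) ?_
      (measure_union_null hg.ae_eq_mk (ae_eq_set.1 hRae).2)
    exact fun t ht ↦ (em (g t = hg.mk g t)).elim (fun h ↦ .inr ⟨⟨ht.1, h⟩, ht.2⟩) .inl

variable {Y : Type u} [MeasurableSpace Y] {κ : Measure Y} {Z : Type*} [MeasurableSpace Z]
  {Φ : Y → Z}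

theorem IsIsoMod0.nullMeasurable_extend {W : Type v} [MeasurableSpace W] {ν : Measure W}
    {Y₀ : Set W} {ψ : Y → W} (hψ : IsIsoMod0 κ ν univ Y₀ ψ) (hΦ : Measurable Φ) (z : Z) :
    NullMeasurable (Function.extend ψ Φ fun _ ↦ z) ν := by
  have himage : ∀ s, MeasurableSet s → NullMeasurableSet (ψ '' s) ν := fun s hs ↦
    (hψ.nullMeasurableSet_image_iff s (subset_univ _)).2 hs.nullMeasurableSet
  have hψinj : Function.Injective ψ := injOn_univ.1 hψ.bijOn.injOn
  intro s hs
  have hpre : Function.extend ψ Φ (fun _ ↦ z) ⁻¹' s =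
      ψ '' (Φ ⁻¹' s) ∪ (ψ '' univ)ᶜ ∩ {_t | z ∈ s} := by
    ext t
    by_cases ht : t ∈ range ψ
    · obtain ⟨y, rfl⟩ := ht
      simp [hψinj.extend_apply, hψinj.eq_iff]
    · have hne : ∀ y, ψ y ≠ t := fun y hy ↦ ht ⟨y, hy⟩
      simp [hne]
  rw [hpre]
  exact (himage _ (hΦ hs)).union
    ((himage _ .univ).compl.inter (MeasurableSet.const _).nullMeasurableSet)

theorem IsIsoMod0.exists_measurableSet_subset_image {W : Type v} [MeasurableSpace W]
    [StandardBorelSpace W] {ν : Measure W} {Y₀ : Set W} {ψ : Y → W}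
    (hψ : IsIsoMod0 κ ν univ Y₀ ψ) [StandardBorelSpace Z] (hΦ : Measurable Φ)
    (hinj : Function.Injective Φ) {A : Set Y} (hA : MeasurableSet A) :
    ∃ Q ⊆ Φ '' A, MeasurableSet Q ∧ κ (A \ Φ ⁻¹' Q) = 0 := by
  rcases isEmpty_or_nonempty Y with hY | ⟨⟨y₀⟩⟩
  · exact ⟨∅, empty_subset _, .empty, by simp [eq_empty_of_isEmpty A]⟩
  have hψinj : Function.Injective ψ := injOn_univ.1 hψ.bijOn.injOn
  set g : W → Z := Function.extend ψ Φ fun _ ↦ Φ y₀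
  have hgψ : ∀ y, g (ψ y) = Φ y := hψinj.extend_apply Φ _
  have hginj : InjOn g (ψ '' A) := by
    rintro _ ⟨y, -, rfl⟩ _ ⟨y', -, rfl⟩ h
    rw [hgψ, hgψ] at h
    rw [hinj h]
  obtain ⟨R, hRA, hR, hR0⟩ := exists_subset_measurableSet_image
    (hψ.nullMeasurable_extend hΦ _).aemeasurable
    ((hψ.nullMeasurableSet_image_iff A (subset_univ _)).2 hA.nullMeasurableSet) hginj
  refine ⟨g '' R, ?_, hR, ?_⟩
  · rintro _ ⟨t, ht, rfl⟩
    obtain ⟨y, hy, rfl⟩ := hRA ht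
    exact ⟨y, hy, (hgψ y).symm⟩
  · rw [← hψ.measure_image _ (subset_univ _) (hA.diff (hΦ hR)).nullMeasurableSet]
    refine measure_mono_null ?_ hR0
    rintro _ ⟨y, ⟨hyA, hy⟩, rfl⟩
    exact ⟨mem_image_of_mem ψ hyA, fun hyR ↦ hy ⟨ψ y, hyR, hgψ y⟩⟩

theorem IsIsoMod0.innerRegularCompactLTTop [TopologicalSpace Y] [IsFiniteMeasure κ]
    {W : Type v} [MeasurableSpace W] [StandardBorelSpace W] {ν : Measure W} {Y₀ : Set W}
    {ψ : Y → W} (hψ : IsIsoMod0 κ ν univ Y₀ ψ) [TopologicalSpace Z] [PolishSpace Z] [BorelSpace Z]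
    (hind : Topology.IsInducing Φ) (hΦ : Measurable Φ) (hinj : Function.Injective Φ) :
    κ.InnerRegularCompactLTTop where
  innerRegular := by
    rintro A ⟨hA, -⟩ r hr
    obtain ⟨Q, hQA, hQ, hAQ⟩ := hψ.exists_measurableSet_subset_image hΦ hinj hA
    have hpre : ∀ S ⊆ Φ '' A, Φ ⁻¹' S ⊆ A := fun S hS ↦
      (preimage_mono hS).trans (preimage_image_eq A hinj).subset
    have hκA : κ A = κ.map Φ Q := by
      rw [Measure.map_apply hΦ hQ, measure_congr (ae_eq_set.2 ⟨hAQ, ?_⟩)]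
      rw [sdiff_eq_empty.2 (hpre Q hQA), measure_empty]
    obtain ⟨K, hKQ, hK, hrK⟩ :=
      hQ.exists_lt_isCompact_of_ne_top (measure_ne_top _ _) (hr.trans_eq hκA)
    rw [Measure.map_apply hΦ hK.measurableSet] at hrK
    have hKA := hKQ.trans hQA
    exact ⟨Φ ⁻¹' K, hpre K hKA,
      (hind.isCompact_preimage_iff (hKA.trans (image_subset_range _ _))).2 hK, hrK⟩

theorem regular_of_innerRegularCompactLTTop [TopologicalSpace Y] [T2Space Y]
    [OpensMeasurableSpace Y] [IsFiniteMeasure κ] [κ.InnerRegularCompactLTTop] : κ.Regular where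
  outerRegular A hA r hr := by
    obtain ⟨K, hKA, hK, hlt⟩ := hA.compl.exists_isCompact_sdiff_lt (measure_ne_top κ _)
      (tsub_pos_of_lt hr).ne'
    refine ⟨Kᶜ, subset_compl_comm.1 hKA, hK.isClosed.isOpen_compl, ?_⟩
    calc κ Kᶜ ≤ κ (A ∪ (Aᶜ \ K)) :=
          measure_mono fun x hx ↦ (em (x ∈ A)).imp_right fun hxA ↦ ⟨hxA, hx⟩
      _ ≤ κ A + κ (Aᶜ \ K) := measure_union_le _ _
      _ < κ A + (r - κ A) := ENNReal.add_lt_add_left (measure_ne_top _ _) hlt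
      _ = r := add_tsub_cancel_of_le hr.le
  innerRegular _ hU _ hr :=
    hU.measurableSet.exists_lt_isCompact_of_ne_top (measure_ne_top _ _) hr

end Regularity

section Subtype

variable {X : Type u} [MeasurableSpace X] {μ : Measure X} {X₁ : Set X} {T : X → X}

theorem isComplete_comap_val [μ.IsComplete] (hX₁ : MeasurableSet X₁) :
    (μ.comap ((↑) : X₁ → X)).IsComplete := by
  refine ⟨fun s hs ↦ ?_⟩
  rw [comap_subtype_coe_apply hX₁] at hs
  exact (MeasurableEmbedding.subtype_coe hX₁).measurableSet_image.1 (measurableSet_of_null hs)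

theorem map_val_comap_val (hX₁ : MeasurableSet X₁) (h : μ X₁ᶜ = 0) :
    (μ.comap ((↑) : X₁ → X)).map (↑) = μ := by
  rw [map_comap_subtype_coe hX₁, Measure.restrict_eq_self_of_ae_mem (mem_ae_iff.2 h)]

theorem comap_val_apply_preimage (hX₁ : MeasurableSet X₁) (h : μ X₁ᶜ = 0) (A : Set X) :
    μ.comap ((↑) : X₁ → X) ((↑) ⁻¹' A) = μ A := by
  rw [← (MeasurableEmbedding.subtype_coe hX₁).map_apply, map_val_comap_val hX₁ h]

theorem nullMeasurableSet_comap_val_iff [μ.IsComplete] (hX₁ : MeasurableSet X₁) (A : Set X₁) :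
    NullMeasurableSet A (μ.comap ((↑) : X₁ → X)) ↔ NullMeasurableSet ((↑) '' A : Set X) μ := by
  have := isComplete_comap_val (μ := μ) hX₁
  have himage := (MeasurableEmbedding.subtype_coe hX₁).measurableSet_image (s := A)
  exact ⟨fun h ↦ (himage.2 h.measurable_of_complete).nullMeasurableSet,
    fun h ↦ (himage.1 h.measurable_of_complete).nullMeasurableSet⟩

theorem IsIsoMod0.measurableSet_source [μ.IsComplete] {Y : Type v} [MeasurableSpace Y]
    {ν : Measure Y} {X₀ : Set X} {Y₀ : Set Y} {φ : X → Y} (hφ : IsIsoMod0 μ ν X₀ Y₀ φ) :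
    MeasurableSet X₀ :=
  (NullMeasurableSet.of_null hφ.conull_source).of_compl.measurable_of_complete

theorem IsIsoMod0.comp_val [μ.IsComplete] {Y : Type v} [MeasurableSpace Y] {ν : Measure Y}
    {X₀ : Set X} {Y₀ : Set Y} {φ : X → Y} (hφ : IsIsoMod0 μ ν X₀ Y₀ φ)
    (hX₁ : MeasurableSet X₁) (h : μ X₁ᶜ = 0) (hsub : X₁ ⊆ X₀) :
    IsIsoMod0 (μ.comap ((↑) : X₁ → X)) ν univ (φ '' X₁) fun x ↦ φ x where
  conull_source := by simp
  conull_target := by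
    have hnull : μ (X₀ \ X₁) = 0 := measure_mono_null (fun _ hx ↦ hx.2) h
    have himage := hφ.measure_image (X₀ \ X₁) sdiff_subset (.of_null hnull)
    refine measure_mono_null (t := Y₀ᶜ ∪ φ '' (X₀ \ X₁)) (fun y hy ↦ ?_)
      (measure_union_null hφ.conull_target (himage.trans hnull))
    by_cases hy₀ : y ∈ Y₀
    · obtain ⟨x, hx, rfl⟩ := hφ.bijOn.surjOn hy₀
      exact .inr ⟨x, ⟨hx, fun hx₁ ↦ hy ⟨x, hx₁, rfl⟩⟩, rfl⟩
    · exact .inl hy₀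
  bijOn := by
    have hval : BijOn (fun x : X₁ ↦ (x : X)) univ X₁ :=
      ⟨fun x _ ↦ x.2, Subtype.val_injective.injOn, fun x hx ↦ ⟨⟨x, hx⟩, trivial, rfl⟩⟩
    exact (hφ.bijOn.subset_left hsub).comp hval
  nullMeasurableSet_image_iff A _ := by
    rw [nullMeasurableSet_comap_val_iff hX₁, ← hφ.nullMeasurableSet_image_iff, image_image]
    exact (Subtype.coe_image_subset X₁ A).trans hsub
  measure_image A _ hA := by
    rw [nullMeasurableSet_comap_val_iff hX₁] at hA
    rw [comap_subtype_coe_apply hX₁, ← hφ.measure_image _ _ hA, image_image]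
    exact (Subtype.coe_image_subset X₁ A).trans hsub

theorem areIsomorphic_restrict [μ.IsComplete] (hX₁ : MeasurableSet X₁) (h : μ X₁ᶜ = 0)
    (hne : X₁.Nonempty) (hT : MapsTo T X₁ X₁) :
    AreIsomorphic μ T (μ.comap ((↑) : X₁ → X)) (hT.restrict T X₁ X₁) := by
  have := hne.to_subtype
  set φ : X → X₁ := Function.invFun (↑)
  have hφ : Function.LeftInverse φ (↑) := Function.leftInverse_invFun Subtype.val_injective
  have hval : ∀ x ∈ X₁, (φ x : X) = x := fun x hx ↦ congrArg Subtype.val (hφ ⟨x, hx⟩)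
  have himage : ∀ A ⊆ X₁, ((↑) '' (φ '' A) : Set X) = A := fun A hA ↦ by
    rw [image_image, image_congr fun x hx ↦ hval x (hA hx), image_id']
  refine ⟨X₁, univ, φ, ⟨h, by simp, ⟨fun _ _ ↦ trivial, fun x hx y hy hxy ↦ ?_,
    fun x _ ↦ ⟨x, x.2, hφ x⟩⟩, fun A hA ↦ ?_, fun A hA _ ↦ ?_⟩, hT, fun _ _ ↦ trivial,
    fun x hx ↦ Subtype.ext ?_⟩
  · rw [← hval x hx, ← hval y hy, hxy]
  · rw [nullMeasurableSet_comap_val_iff hX₁, himage A hA]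
  · rw [comap_subtype_coe_apply hX₁, himage A hA]
  · rw [hval _ (hT hx), MapsTo.val_restrict_apply, hval x hx]

theorem IsNonsingular.restrict (hT : IsNonsingular μ T) (hX₁ : MeasurableSet X₁) (h : μ X₁ᶜ = 0)
    (hmaps : MapsTo T X₁ X₁) :
    IsNonsingular (μ.comap ((↑) : X₁ → X)) (hmaps.restrict T X₁ X₁) := by
  refine ⟨(hT.measurable.comp measurable_subtype_coe).subtype_mk, ?_⟩
  rintro _ ⟨A, hA, rfl⟩
  change μ.comap ((↑) : X₁ → X) ((↑) ⁻¹' (T ⁻¹' A)) = 0 ↔ _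
  rw [comap_val_apply_preimage hX₁ h, comap_val_apply_preimage hX₁ h, hT.preimage_null_iff A hA]

theorem IsLebesgueSpace.comap_val (hX : IsLebesgueSpace μ) {X₀ : Set X} {Y₀ : Set ℝ} {φ : X → ℝ}
    (hφ : IsIsoMod0 μ (volume.restrict {t : ℝ | 0 ≤ t ∧ ENNReal.ofReal t < μ univ}) X₀ Y₀ φ)
    (hX₁ : MeasurableSet X₁) (h : μ X₁ᶜ = 0) (hsub : X₁ ⊆ X₀) :
    IsLebesgueSpace (μ.comap ((↑) : X₁ → X)) := by
  have := hX.complete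
  refine ⟨isComplete_comap_val hX₁, univ, φ '' X₁, fun x ↦ φ x, ?_⟩
  have huniv : μ.comap ((↑) : X₁ → X) univ = μ univ := comap_val_apply_preimage hX₁ h univ
  rw [huniv]
  exact hφ.comp_val hX₁ h hsub

theorem IsNonsingular.quasiMeasurePreserving (hT : IsNonsingular μ T) :
    Measure.QuasiMeasurePreserving T μ μ :=
  ⟨hT.measurable, .mk fun s hs hs0 ↦ by
    rw [Measure.map_apply hT.measurable hs, hT.preimage_null_iff s hs, hs0]⟩

theorem IsNonsingular.exists_mapsTo_subset (hT : IsNonsingular μ T) {G : Set X}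
    (hG : MeasurableSet G) (hG0 : μ Gᶜ = 0) :
    ∃ X₁ ⊆ G, MeasurableSet X₁ ∧ μ X₁ᶜ = 0 ∧ MapsTo T X₁ X₁ := by
  refine ⟨⋂ n, T^[n] ⁻¹' G, iInter_subset _ 0, .iInter fun n ↦ hT.measurable.iterate n hG, ?_,
    fun x hx ↦ mem_iInter.2 fun n ↦ mem_iInter.1 hx (n + 1)⟩
  rw [compl_iInter, measure_iUnion_null_iff]
  exact fun n ↦ (hT.quasiMeasurePreserving.iterate n).preimage_null hG0

end Subtype

section Metric

theorem isGoodMetric_induced {Y : Type u} [MeasurableSpace Y] {κ : Measure Y} [IsFiniteMeasure κ]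
    {W : Type v} [MeasurableSpace W] [StandardBorelSpace W] {ν : Measure W} {Y₀ : Set W}
    {ψ : Y → W} (hψ : IsIsoMod0 κ ν univ Y₀ ψ) {Z : Type*} [MetricSpace Z] [PolishSpace Z]
    [MeasurableSpace Z] [BorelSpace Z] {Φ : Y → Z} (hΦ : Measurable Φ)
    (hinj : Function.Injective Φ) (hsupp : ∀ y, Φ y ∈ (κ.map Φ).support) :
    @IsGoodMetric Y _ (.induced Φ hinj inferInstance) κ := by
  let := MetricSpace.induced Φ hinj inferInstance
  have hind : Topology.IsInducing Φ := ⟨rfl⟩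
  have hopen : ∀ U : Set Y, IsOpen U → MeasurableSet U := fun U hU ↦ by
    obtain ⟨V, hV, rfl⟩ := hind.isOpen_iff.1 hU
    exact hΦ hV.measurableSet
  refine ⟨hopen, fun U hU ⟨y, hy⟩ ↦ ?_, ?_⟩
  · obtain ⟨V, hV, rfl⟩ := hind.isOpen_iff.1 hU
    rw [← Measure.map_apply hΦ hV.measurableSet]
    exact (Measure.mem_support_iff_forall _).1 (hsupp y) V (hV.mem_nhds hy)
  · have : OpensMeasurableSpace Y := ⟨MeasurableSpace.generateFrom_le hopen⟩
    have := hψ.innerRegularCompactLTTop hind hΦ hinj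
    exact regular_of_innerRegularCompactLTTop

variable {X : Type u} [MeasurableSpace X] {μ : Measure X} {T : X → X}
  {Z : Type*} [MetricSpace Z] [PolishSpace Z] [MeasurableSpace Z] [BorelSpace Z] {Φ : X → Z}

theorem measure_compl_preimage_support_map (hΦ : Measurable Φ) :
    μ (Φ ⁻¹' (μ.map Φ).support)ᶜ = 0 := by
  rw [← preimage_compl, ← Measure.map_apply hΦ Measure.isClosed_support.measurableSet.compl]
  exact Measure.measure_compl_support

variable [IsFiniteMeasure μ]

theorem IsMeasurablySensitive.exists_pos_eventually_of_mapsTo (hsens : IsMeasurablySensitive μ T)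
    (hX : IsLebesgueSpace μ) (hT : IsNonsingular μ T) {X₀ X₁ : Set X} {Y₀ : Set ℝ} {φ : X → ℝ}
    (hφ : IsIsoMod0 μ (volume.restrict {t : ℝ | 0 ≤ t ∧ ENNReal.ofReal t < μ univ}) X₀ Y₀ φ)
    (hX₁ : MeasurableSet X₁) (h : μ X₁ᶜ = 0) (hne : X₁.Nonempty) (hsub : X₁ ⊆ X₀)
    (hmaps : MapsTo T X₁ X₁) (hΦ : Measurable Φ) (hinj : InjOn Φ X₁)
    (hsupp : MapsTo Φ X₁ (μ.map Φ).support) :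
    ∃ δ : ℝ, 0 < δ ∧ ∀ x ∈ X₁, ∀ ε : ℝ, 0 < ε → ∀ᶠ n in atTop,
      0 < μ {y | dist (Φ y) (Φ x) < ε ∧ δ < dist (Φ (T^[n] x)) (Φ (T^[n] y))} := by
  have := hX.complete
  have hinj₁ : Function.Injective fun x : X₁ ↦ Φ x := injOn_iff_injective.1 hinj
  have hfin : IsFiniteMeasure (μ.comap ((↑) : X₁ → X)) :=
    ⟨(comap_val_apply_preimage hX₁ h univ).trans_lt (measure_lt_top _ _)⟩
  have hmap : (μ.comap ((↑) : X₁ → X)).map (fun x : X₁ ↦ Φ x) = μ.map Φ := by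
    rw [← Function.comp_def Φ, ← Measure.map_map hΦ measurable_subtype_coe,
      map_val_comap_val hX₁ h]
  let := MetricSpace.induced (fun x : X₁ ↦ Φ x) hinj₁ inferInstance
  obtain ⟨δ, hδ, hs⟩ := hsens X₁ (μ.comap (↑)) (hmaps.restrict T X₁ X₁)
    (hX.comap_val hφ hX₁ h hsub) (hT.restrict hX₁ h hmaps)
    (areIsomorphic_restrict hX₁ h hne hmaps)
    (isGoodMetric_induced (hφ.comp_val hX₁ h hsub) (hΦ.comp measurable_subtype_coe) hinj₁
      fun x ↦ hmap ▸ hsupp x.2)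
  refine ⟨δ, hδ, fun x hx ε hε ↦ ?_⟩
  obtain ⟨N, hN⟩ := hs ⟨x, hx⟩ ε hε
  filter_upwards [eventually_ge_atTop N] with n hn
  refine (hN n hn).trans_le ?_
  rw [comap_subtype_coe_apply hX₁]
  refine measure_mono ?_
  rintro _ ⟨y, ⟨hy, hdist⟩, rfl⟩
  rw [hmaps.iterate_restrict] at hdist
  exact ⟨hy, hdist⟩

theorem IsMeasurablySensitive.exists_pos_ae_eventually (hsens : IsMeasurablySensitive μ T)
    (hμ : μ ≠ 0) (hX : IsLebesgueSpace μ) (hT : IsNonsingular μ T) (hΦ : Measurable Φ) {G : Set X}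
    (hG : MeasurableSet G) (hG0 : μ Gᶜ = 0) (hinj : InjOn Φ G) :
    ∃ δ : ℝ, 0 < δ ∧ ∀ᵐ x ∂μ, ∀ ε : ℝ, 0 < ε → ∀ᶠ n in atTop,
      0 < μ {y | dist (Φ y) (Φ x) < ε ∧ δ < dist (Φ (T^[n] x)) (Φ (T^[n] y))} := by
  obtain ⟨X₀, Y₀, φ, hφ⟩ := hX.exists_iso
  have := hX.complete
  have hX₀ := hφ.measurableSet_source
  have hsupp : MeasurableSet (Φ ⁻¹' (μ.map Φ).support) :=
    hΦ Measure.isClosed_support.measurableSet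
  have hnull : μ (X₀ ∩ G ∩ Φ ⁻¹' (μ.map Φ).support)ᶜ = 0 := by
    rw [compl_inter, compl_inter]
    exact measure_union_null (measure_union_null hφ.conull_source hG0)
      (measure_compl_preimage_support_map hΦ)
  obtain ⟨X₁, hsub, hX₁, h, hmaps⟩ := hT.exists_mapsTo_subset ((hX₀.inter hG).inter hsupp) hnull
  have := ae_neBot.2 hμ
  obtain ⟨δ, hδ, hs⟩ := hsens.exists_pos_eventually_of_mapsTo hX hT hφ hX₁ h
    (nonempty_of_mem (mem_ae_iff.2 h)) (fun x hx ↦ (hsub hx).1.1) hmaps hΦ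
    (hinj.mono fun x hx ↦ (hsub hx).1.2) fun x hx ↦ (hsub hx).2
  exact ⟨δ, hδ, mem_of_superset (mem_ae_iff.2 h) hs⟩

end Metric

section Coding

variable {X : Type*} {F : ℕ → Set X} {U : ℕ → Set X}

/-- The itinerary of a point with respect to a sequence of sets: the `i`-th entry of
`coding F x` tells whether `x` belongs to `F i`. -/
noncomputable def coding (F : ℕ → Set X) (x : X) : ℕ → Bool := fun i ↦ (F i).boolIndicator x

theorem coding_apply_eq_iff {x y : X} {i : ℕ} :
    coding F x i = coding F y i ↔ (x ∈ F i ↔ y ∈ F i) := by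
  rw [mem_iff_boolIndicator, mem_iff_boolIndicator, ← Bool.eq_iff_iff, coding, coding]

theorem measurable_coding [MeasurableSpace X] (hF : ∀ i, MeasurableSet (F i)) :
    Measurable (coding F) :=
  measurable_pi_lambda _ fun i ↦ measurable_to_bool <| by
    simpa only [coding, preimage_boolIndicator_true] using hF i

theorem exists_sequence_sdiff_disjoint [MeasurableSpace X] (hUm : ∀ k, MeasurableSet (U k))
    (hU : Antitone U) {ι : Type*} [Countable ι] [Nonempty ι] {E : ι → Set X}
    (hE : ∀ j, MeasurableSet (E j)) :
    ∃ F : ℕ → Set X, (∀ i, MeasurableSet (F i)) ∧ (∀ i, Disjoint (F i) (U i)) ∧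
      ∀ j k, ∃ i, F i = E j \ U k := by
  obtain ⟨f, hf⟩ := exists_surjective_nat ι
  refine ⟨fun i ↦ E (f i.unpair.1) \ U i.unpair.2, fun i ↦ (hE _).diff (hUm _),
    fun i ↦ disjoint_sdiff_left.mono_right (hU (Nat.unpair_right_le i)), fun j k ↦ ?_⟩
  obtain ⟨i, rfl⟩ := hf j
  exact ⟨Nat.pair i k, by simp⟩

theorem injOn_coding (hU : Antitone U) {ι : Type*} {E : ι → Set X} {X₀ : Set X}
    (hE : ∀ x ∈ X₀, ∀ y ∈ X₀, (∀ j, x ∈ E j ↔ y ∈ E j) → x = y)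
    (hF : ∀ j k, ∃ i, F i = E j \ U k) : InjOn (coding F) (X₀ \ ⋂ k, U k) := by
  rintro x ⟨hx, hxU⟩ y ⟨hy, hyU⟩ hxy
  refine hE x hx y hy fun j ↦ ?_
  obtain ⟨k, hk⟩ := not_forall.1 (mt mem_iInter.2 hxU)
  obtain ⟨l, hl⟩ := not_forall.1 (mt mem_iInter.2 hyU)
  obtain ⟨i, hi⟩ := hF j (max k l)
  have hxy := coding_apply_eq_iff.1 (congrFun hxy i)
  rw [hi] at hxy
  exact ⟨fun h ↦ (hxy.1 ⟨h, fun hxU ↦ hk (hU (le_max_left k l) hxU)⟩).1,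
    fun h ↦ (hxy.2 ⟨h, fun hyU ↦ hl (hU (le_max_right k l) hyU)⟩).1⟩

attribute [local instance] PiNat.metricSpace

theorem dist_coding_le (hU : Antitone U) (hF : ∀ i, Disjoint (F i) (U i)) {m : ℕ} {x y : X}
    (hx : x ∈ U m) (hy : y ∈ U m) : dist (coding F x) (coding F y) ≤ (1 / 2) ^ m := by
  refine PiNat.mem_cylinder_iff_dist_le.1 fun i hi ↦ coding_apply_eq_iff.2 ?_
  exact iff_of_false (fun h ↦ disjoint_left.1 (hF i) h (hU hi.le hx))
    fun h ↦ disjoint_left.1 (hF i) h (hU hi.le hy)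

end Coding

section Sensitivity

variable {X : Type u} [MeasurableSpace X] {μ : Measure X} {T : X → X}

theorem IsNonsingular.of_measurePreserving (hT : MeasurePreserving T μ μ) : IsNonsingular μ T :=
  ⟨hT.measurable, fun A hA ↦ by rw [hT.measure_preimage hA.nullMeasurableSet]⟩

theorem IsIsoMod0.exists_measurableSet_separating [μ.IsComplete] {ν : Measure ℝ}
    {X₀ : Set X} {Y₀ : Set ℝ} {φ : X → ℝ} (hφ : IsIsoMod0 μ ν X₀ Y₀ φ) :
    ∃ E : ℚ → Set X, (∀ q, MeasurableSet (E q)) ∧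
      ∀ x ∈ X₀, ∀ y ∈ X₀, (∀ q, x ∈ E q ↔ y ∈ E q) → x = y := by
  refine ⟨fun q ↦ X₀ ∩ φ ⁻¹' Iio (q : ℝ), fun q ↦ ?_, fun x hx y hy hxy ↦ ?_⟩
  · refine NullMeasurableSet.measurable_of_complete (μ := μ)
      ((hφ.nullMeasurableSet_image_iff _ inter_subset_left).1 ?_)
    rw [image_inter_preimage, hφ.bijOn.image_eq]
    exact (NullMeasurableSet.of_null hφ.conull_target).of_compl.inter
      measurableSet_Iio.nullMeasurableSet
  · by_contra hne
    rcases lt_or_gt_of_ne fun h ↦ hne (hφ.bijOn.injOn hx hy h) with hlt | hlt <;>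
      obtain ⟨q, hq₁, hq₂⟩ := exists_rat_btwn hlt
    · exact hq₂.not_gt ((hxy q).1 ⟨hx, hq₁⟩).2
    · exact hq₂.not_gt ((hxy q).2 ⟨hy, hq₁⟩).2

theorem IsFrequentTarget.mono {C D : Set X} (hC : IsFrequentTarget μ T C) (h : C ⊆ D) :
    IsFrequentTarget μ T D := by
  obtain ⟨B, hB, hB0, hBC⟩ := hC
  exact ⟨B, hB, hB0, hBC.mono fun k hk ↦ hk.trans (preimage_mono h).eventuallyLE⟩

theorem exists_antitone_isFrequentTarget (h : ¬ HasLargeFrequentTargets μ T) :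
    ∃ U : ℕ → Set X, (∀ k, MeasurableSet (U k)) ∧ Antitone U ∧
      Tendsto (fun k ↦ μ (U k)) atTop (𝓝 0) ∧ ∀ k, IsFrequentTarget μ T (U k) := by
  unfold HasLargeFrequentTargets at h
  push Not at h
  obtain ⟨ε, hε, hsum⟩ := ENNReal.exists_pos_sum_of_countable one_ne_zero ℕ
  choose C hC hCT hCε using fun m ↦ h (ε m) (ENNReal.coe_pos.2 (hε m))
  refine ⟨fun k ↦ ⋃ m, C (m + k), fun k ↦ .iUnion fun m ↦ hC _, fun k l hkl ↦ ?_, ?_, fun k ↦ ?_⟩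
  · refine iUnion_subset fun m ↦ ?_
    have := subset_iUnion (fun m ↦ C (m + k)) (m + (l - k))
    rwa [add_assoc, Nat.sub_add_cancel hkl] at this
  · refine tendsto_of_tendsto_of_tendsto_of_le_of_le tendsto_const_nhds
      (ENNReal.tendsto_sum_nat_add (fun m ↦ (ε m : ℝ≥0∞)) (hsum.trans ENNReal.one_lt_top).ne)
      (fun _ ↦ zero_le) fun k ↦ ?_
    exact (measure_iUnion_le _).trans (ENNReal.tsum_le_tsum fun m ↦ (hCε _).le)
  · exact (hCT k).mono (by simpa using subset_iUnion (fun m ↦ C (m + k)) 0)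

theorem ae_forall_iterate_mem (B C : Set X) :
    ∀ᵐ x ∂μ, ∀ n, B ≤ᵐ[μ] T^[n] ⁻¹' C → x ∈ B → T^[n] x ∈ C :=
  ae_all_iff.2 fun n ↦ by
    by_cases h : B ≤ᵐ[μ] T^[n] ⁻¹' C
    · filter_upwards [h] with x hx _ hxB using hx hxB
    · exact .of_forall fun x h' ↦ absurd h' h

theorem IsLebesgueSpace.exists_injOn_coding (hX : IsLebesgueSpace μ) {U : ℕ → Set X}
    (hUm : ∀ k, MeasurableSet (U k)) (hU : Antitone U)
    (hUlim : Tendsto (fun k ↦ μ (U k)) atTop (𝓝 0)) {B : ℕ → Set X}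
    (hB : ∀ m, MeasurableSet (B m)) :
    ∃ F : ℕ → Set X, (∀ i, MeasurableSet (F i)) ∧ (∀ i, Disjoint (F i) (U i)) ∧
      (∀ m k, ∃ i, F i = B m \ U k) ∧
      ∃ G, MeasurableSet G ∧ μ Gᶜ = 0 ∧ InjOn (coding F) G := by
  obtain ⟨X₀, Y₀, φ, hφ⟩ := hX.exists_iso
  have := hX.complete
  obtain ⟨E, hE, hEsep⟩ := hφ.exists_measurableSet_separating
  have hU0 : μ (⋂ k, U k) = 0 :=
    le_zero_iff.1 <| ge_of_tendsto' hUlim fun k ↦ measure_mono (iInter_subset U k)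
  obtain ⟨F, hF, hFU, hFE⟩ := exists_sequence_sdiff_disjoint hUm hU (E := Sum.elim E B)
    (Sum.forall.2 ⟨hE, hB⟩)
  refine ⟨F, hF, hFU, fun m ↦ hFE (.inr m), X₀ \ ⋂ k, U k,
    hφ.measurableSet_source.diff (.iInter hUm), ?_,
    injOn_coding hU hEsep fun q ↦ hFE (.inl q)⟩
  rw [compl_sdiff, union_comm]
  exact measure_union_null hφ.conull_source hU0

attribute [local instance] PiNat.metricSpace

theorem IsMeasurablySensitive.hasLargeFrequentTargets [IsFiniteMeasure μ]
    (hsens : IsMeasurablySensitive μ T) (hμ : μ ≠ 0) (hX : IsLebesgueSpace μ)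
    (hT : IsNonsingular μ T) : HasLargeFrequentTargets μ T := by
  by_contra hsmall
  obtain ⟨U, hUm, hU, hUlim, hUT⟩ := exists_antitone_isFrequentTarget hsmall
  choose B hB hB0 hBU using hUT
  obtain ⟨F, hF, hFU, hFB, G, hG, hG0, hinj⟩ := hX.exists_injOn_coding hUm hU hUlim hB
  have : PolishSpace (ℕ → Bool) := {}
  obtain ⟨δ, hδ, hs⟩ :=
    hsens.exists_pos_ae_eventually hμ hX hT (measurable_coding hF) hG hG0 hinj
  obtain ⟨m, hm⟩ := exists_pow_lt_of_lt_one hδ (one_half_lt_one (α := ℝ))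
  obtain ⟨k, hk⟩ := (hUlim.eventually_lt_const (hB0 m)).exists
  obtain ⟨i, hi⟩ := hFB m k
  have hFpos : 0 < μ (F i) := by
    rw [hi]
    exact (tsub_pos_of_lt hk).trans_le le_measure_sdiff
  have hFsub : F i ⊆ B m := hi.subset.trans sdiff_subset
  obtain ⟨x, hxF, hxU, hxs⟩ := exists_mem_of_ae hFpos ((ae_forall_iterate_mem (B m) (U m)).and hs)
  obtain ⟨n, hBn, hn⟩ := ((hBU m).and_eventually (hxs ((1 / 2) ^ i) (by positivity))).exists
  refine hn.ne' (measure_mono_null ?_ (ae_le_set.1 hBn))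
  rintro y ⟨hy, hdist⟩
  have hyF : y ∈ F i := (coding_apply_eq_iff.1 (PiNat.apply_eq_of_dist_lt hy le_rfl)).2 hxF
  refine ⟨hFsub hyF, fun hyU ↦ hdist.not_ge ?_⟩
  exact (dist_coding_le hU hFU (hxU n hBn (hFsub hxF)) hyU).trans hm.le

end Sensitivity
end MeasurableSensitivity

theorem mainTheorem1 {X : Type u} [MeasurableSpace X] (μ : Measure X) [IsFiniteMeasure μ]
    (hμ : μ ≠ 0) (hX : MeasurableSensitivity.IsLebesgueSpace μ)
    (T : X → X) (hT : Ergodic T μ)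
    (hsens : MeasurableSensitivity.IsMeasurablySensitive μ T) :
    ∃ n : ℕ, 1 ≤ n ∧ ∃ A : Fin n → Set X,
      (∀ i, MeasurableSet (A i)) ∧
      (∀ i, 0 < μ (A i)) ∧
      (∀ i j, i ≠ j → Disjoint (A i) (A j)) ∧
      (∀ i, T^[n] ⁻¹' (A i) = A i) ∧
      μ (⋃ i, A i)ᶜ = 0 ∧
      (∀ i, MeasurableSensitivity.IsLightlyMixing (μ.restrict (A i)) (T^[n])) := by
  have hlarge := hsens.hasLargeFrequentTargets hμ hX (.of_measurePreserving hT.toMeasurePreserving)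
  obtain ⟨n, hn, A, hA, hdisj, hcover, herg⟩ :=
    MeasurableSensitivity.exists_cyclic_decomposition hμ hT hlarge
  exact ⟨n, hn, A, fun i ↦ (hA i).measurableSet, fun i ↦ (hA i).measure_pos,
    fun i j hij ↦ hdisj hij, fun i ↦ (hA i).preimage_eq, hcover,
    fun i ↦ (herg i).isLightlyMixing (hlarge.restrict_iterate (hA i))⟩
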